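/- For integers $k\ge 1$ and $n\ge 1$, let $\mathrm{vdW}(n,k)$ be the simplicial complex on the vertex set $\{1,2,\ldots,n\}$ whose facets are the arithmetic progressions $\{x,\,x+d,\,x+2d,\,\ldots,\,x+kd\}$, where $d$ is a positive integer and $1\le x<x+kd\le n$. Let $a>1$ be an integer, let $L(a)=\operatorname{lcm}(1,2,\ldots,a)$, let $L(a)=p_1^{\alpha_1}p_2^{\alpha_2}\cdots p_m^{\alpha_m}$ be its prime factorization (with distinct primes $p_i$ and all $\alpha_i\ge 1$), and let $M(a)=\max\{p_1^{\alpha_1-1},p_2^{\alpha_2-1},\ldots,p_m^{\alpha_m-1}\}$. If $k$ and $n$ are integers with $k\ge L(a)/M(a)$ and $k<n\le (a+1)\,k$, then (the geometric realization of) $\mathrm{vdW}(n,k)$ is contractible. -/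

import Mathlib

namespace VanDerWaerden

/-- The arithmetic progression `{x, x + d, x + 2d, …, x + k d}` of length `k`
(that is, with `k` steps and, for `d > 0`, with `k + 1` elements). -/
def progression (x d k : ℕ) : Finset ℕ :=
  (Finset.range (k + 1)).image (fun i => x + i * d)

/-- The van der Waerden complex `vdW(n, k)` on the vertex set `{1, …, n}`: the simplicial complex
generated by the arithmetic progressions `{x, x + d, …, x + k d}` with `d` positive and
`1 ≤ x < x + k d ≤ n`. Its (nonempty) faces are the nonempty subsets of such progressions. -/
def vdW (n k : ℕ) : PreAbstractSimplicialComplex (Finset.Icc 1 n) where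
  faces := {F | F.Nonempty ∧ ∃ x d : ℕ, 0 < d ∧ 1 ≤ x ∧ x < x + k * d ∧ x + k * d ≤ n ∧
    F.map (Function.Embedding.subtype _) ⊆ progression x d k}
  isRelLowerSet_faces := by
    rintro F ⟨hF, x, d, hd, hx, hlt, hle, hsub⟩
    exact ⟨hF, fun G hGF hG =>
      ⟨hG, x, d, hd, hx, hlt, hle, (Finset.map_subset_map.2 hGF).trans hsub⟩⟩

/-- The geometric realization of a simplicial complex `K` with finite vertex set `V`: the points
of the standard simplex on `V` (in barycentric coordinates) that are supported on a face of `K`,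
that is, the union of the closed simplices spanned by the faces of `K`. As a topological space it
carries the subspace topology from `V → ℝ`. -/
def realization {V : Type*} [Fintype V] (K : PreAbstractSimplicialComplex V) : Set (V → ℝ) :=
  {f | f ∈ stdSimplex ℝ V ∧ ∃ s ∈ K.faces, ∀ v, v ∉ s → f v = 0}

/-- `L(a) = lcm(1, 2, …, a)`. -/
def L (a : ℕ) : ℕ := (Finset.Icc 1 a).lcm id

/-- `M(a)`: the maximum of `p ^ (α - 1)`, where `p` runs over the primes dividing `L(a)` and
`p ^ α` is the exact power of `p` dividing `L(a)`. -/
def M (a : ℕ) : ℕ := (L a).primeFactors.sup (fun p => p ^ ((L a).factorization p - 1))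

end VanDerWaerden

namespace VanDerWaerden

/-! Every face other than {1} is matched with another by adding or removing one vertex, compatibly
with inclusion, so the complex can be stripped down to the vertex 1 (`contractibleSpace_of_key`).
Sort faces by their maximum m. By `exists_progression_iff_inLink`, F is a face iff some d ≤ D =
`maxDiff` reaches all of F: d ∣ m - z and m - z ≤ k d for every z in F.

For a prime p attaining M(a), the hypothesis says that p times the p-free part of L(a) is at most k.
So a divisor of L(a) with p-part at most t p is at most k t. Let c be the least power of p above t,
or t + 1 if that power exceeds D: joining c to a set of differences leaves the lcm unchanged or at
most k t (`exists_apex`).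

The level of F is the largest t, up to a cap, such that some difference in [t, D] reaches F. Below
the cap t reaches F and c > t does not; let x be the least element missed by c, and X the lcm of c
and all differences in [t, D] reaching x. Each of these reaches y = m - X, so y toggles freely among
the faces with the same m, t and x. At the cap the same works, and if c reaches all of F, then m - c
toggles. -/

/-- The faces of `K` that do not contain `σ`. -/
def deleteStar {V : Type*} (K : PreAbstractSimplicialComplex V) (σ : Finset V) :
    PreAbstractSimplicialComplex V where
  faces := {τ | τ ∈ K.faces ∧ ¬ σ ⊆ τ}
  isRelLowerSet_faces := by
    rintro τ ⟨hτ, hστ⟩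
    exact ⟨(K.isRelLowerSet_faces hτ).1, fun ρ hρ hne =>
      ⟨(K.isRelLowerSet_faces hτ).2 hρ hne, fun h => hστ (h.trans hρ)⟩⟩

/-! ### Deformation retraction off an open star -/

section push

lemma inf'_eq_zero_of_mem_stdSimplex {V : Type*} [Fintype V] {σ : Finset V}
    {hσ : σ.Nonempty} {f : V → ℝ} {u : V} (hu : u ∈ σ) (hf : f ∈ stdSimplex ℝ V) (hfu : f u = 0) :
    σ.inf' hσ f = 0 :=
  le_antisymm (hfu ▸ Finset.inf'_le f hu) ((Finset.le_inf'_iff hσ f).2 fun i _ => hf.1 i)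

variable {V : Type*} [DecidableEq V]

/-- Move mass from the vertices of `σ` to the vertex `v`: the coordinates of `f` in `σ` are lowered
by `t` times their minimum, and the coordinate at `v` is raised to compensate. -/
noncomputable def push (σ : Finset V) (hσ : σ.Nonempty) (v : V) (t : ℝ) (f : V → ℝ) : V → ℝ :=
  fun w => f w + t * σ.inf' hσ f * ((if w = v then (σ.card : ℝ) else 0) - if w ∈ σ then 1 else 0)

variable {σ : Finset V} {hσ : σ.Nonempty} {v : V}

lemma push_zero (f : V → ℝ) : push σ hσ v 0 f = f := by
  funext w; simp [push]

lemma continuous_push : Continuous fun q : ℝ × (V → ℝ) => push σ hσ v q.1 q.2 := by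
  have h : Continuous fun q : ℝ × (V → ℝ) => σ.inf' hσ q.2 :=
    Continuous.finset_inf'_apply hσ fun i _ => (continuous_apply i).comp continuous_snd
  refine continuous_pi fun w => ?_
  exact (((continuous_apply w).comp continuous_snd)).add ((continuous_fst.mul h).mul continuous_const)

variable [Fintype V] {f : V → ℝ}

lemma push_mem_stdSimplex (hv : v ∉ σ) {t : ℝ} (ht0 : 0 ≤ t) (ht1 : t ≤ 1)
    (hf : f ∈ stdSimplex ℝ V) : push σ hσ v t f ∈ stdSimplex ℝ V := by
  have hμ : 0 ≤ σ.inf' hσ f := (Finset.le_inf'_iff hσ f).2 fun i _ => hf.1 i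
  refine ⟨fun w => ?_, ?_⟩
  · unfold push
    by_cases hw : w ∈ σ
    · have hwv : w ≠ v := fun h => hv (h ▸ hw)
      have h1 : σ.inf' hσ f ≤ f w := Finset.inf'_le f hw
      simp only [hwv, hw, if_true, if_false]
      nlinarith [mul_le_mul_of_nonneg_right ht1 hμ]
    · simp only [hw, if_false, sub_zero]
      have := hf.1 w
      have : 0 ≤ (if w = v then (σ.card : ℝ) else 0) := by split_ifs <;> positivity
      positivity
  · have := hf.2
    simp [push, Finset.sum_add_distrib, this, ← Finset.mul_sum, Finset.sum_sub_distrib]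

variable {K : PreAbstractSimplicialComplex V}

/-- If the carrier s contains σ, the support grows at most by v; otherwise the minimum over σ is
zero and `push` fixes f. -/
lemma push_mem_realization (hv : v ∉ σ) (hK : ∀ τ ∈ K.faces, σ ⊆ τ → insert v τ ∈ K.faces)
    {t : ℝ} (ht0 : 0 ≤ t) (ht1 : t ≤ 1) (hf : f ∈ realization K) :
    push σ hσ v t f ∈ realization K := by
  obtain ⟨hf1, s, hs, hfs⟩ := hf
  refine ⟨push_mem_stdSimplex hv ht0 ht1 hf1, ?_⟩
  by_cases h : σ ⊆ s
  · refine ⟨insert v s, hK s hs h, fun w hw => ?_⟩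
    rw [Finset.mem_insert, not_or] at hw
    have : w ∉ σ := fun h' => hw.2 (h h')
    simp [push, hw.1, this, hfs w hw.2]
  · obtain ⟨u, hu, hus⟩ := Finset.not_subset.1 h
    refine ⟨s, hs, fun w hw => ?_⟩
    simp [push, inf'_eq_zero_of_mem_stdSimplex hu hf1 (hfs u hus), hfs w hw]

lemma push_one_mem_realization (hv : v ∉ σ)
    (hK : ∀ τ ∈ K.faces, σ ⊆ τ → insert v τ ∈ K.faces) (hf : f ∈ realization K) :
    push σ hσ v 1 f ∈ realization (deleteStar K σ) := by
  obtain ⟨hf1, s, hs, hfs⟩ := hf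
  refine ⟨push_mem_stdSimplex hv zero_le_one le_rfl hf1, ?_⟩
  by_cases h : σ ⊆ s
  -- At `t = 1` a vertex attaining the minimum loses all its mass, so it leaves the support.
  · obtain ⟨u, hu, hμ⟩ := Finset.exists_mem_eq_inf' hσ f
    have hvu : v ≠ u := fun h' => hv (h' ▸ hu)
    refine ⟨(insert v s).erase u, ⟨(K.isRelLowerSet_faces (hK s hs h)).2 (Finset.erase_subset _ _)
      ⟨v, by simp [hvu]⟩, fun h' => by simpa using h' hu⟩, fun w hw => ?_⟩
    by_cases hwu : w = u
    · subst hwu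
      simp [push, hu, hvu.symm, hμ]
    · have hw' : w ≠ v ∧ w ∉ s := by simpa [hwu] using hw
      have : w ∉ σ := fun h' => hw'.2 (h h')
      simp [push, hw'.1, this, hfs w hw'.2]
  · obtain ⟨u, hu, hus⟩ := Finset.not_subset.1 h
    refine ⟨s, ⟨hs, h⟩, fun w hw => ?_⟩
    simp [push, inf'_eq_zero_of_mem_stdSimplex hu hf1 (hfs u hus), hfs w hw]

/-- If the link of `σ` is a cone with apex `v`, then removing the open star of `σ` does not
affect contractibility. -/
theorem contractibleSpace_of_deleteStar (hσ : σ.Nonempty) (hv : v ∉ σ)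
    (hK : ∀ τ ∈ K.faces, σ ⊆ τ → insert v τ ∈ K.faces)
    (hc : ContractibleSpace (realization (deleteStar K σ))) :
    ContractibleSpace (realization K) := by
  have hcont : Continuous fun f : realization K => push σ hσ v 1 f.1 :=
    continuous_push.comp (continuous_const.prodMk continuous_subtype_val)
  let r : C(realization K, realization (deleteStar K σ)) :=
    ⟨fun f => ⟨push σ hσ v 1 f.1, push_one_mem_realization hv hK f.2⟩, hcont.subtype_mk _⟩
  let i : C(realization (deleteStar K σ), realization K) :=
    ⟨fun f => ⟨f.1, f.2.1, f.2.2.imp fun _ h => ⟨h.1.1, h.2⟩⟩,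
      continuous_subtype_val.subtype_mk _⟩
  have hr : (i.comp r).Nullhomotopic := by
    have := ((id_nullhomotopic (realization (deleteStar K σ))).comp_right i).comp_left r
    simpa using this
  have hid : (ContinuousMap.id (realization K)).Homotopic (i.comp r) :=
    ⟨{ toFun := fun q => ⟨push σ hσ v q.1 q.2.1,
          push_mem_realization hv hK q.1.2.1 q.1.2.2 q.2.2⟩
       continuous_toFun := (continuous_push.comp ((continuous_subtype_val.comp
          continuous_fst).prodMk (continuous_subtype_val.comp continuous_snd))).subtype_mk _
       map_zero_left := fun f => Subtype.ext (push_zero f.1)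
       map_one_left := fun f => rfl }⟩
  rw [contractible_iff_id_nullhomotopic]
  exact hr.imp fun y hy => hid.trans hy

end push

/-- Suppose the faces of `K` outside a subcomplex `K'` carry a key that is antitone for inclusion,
and that for every value of the key there is a vertex that can be added to and removed from
the faces with this key. Then `K` is contractible if `K'` is. -/
theorem contractibleSpace_of_key {V α : Type*} [Fintype V] [DecidableEq V] [LinearOrder α]
    (key : Finset V → α) (K' : PreAbstractSimplicialComplex V)
    (hK' : ContractibleSpace (realization K')) (K : PreAbstractSimplicialComplex V)
    (hle : K'.faces ⊆ K.faces)
    (hkey : ∀ F ∈ K.faces \ K'.faces, ∀ G ∈ K.faces \ K'.faces, F ⊆ G → key G ≤ key F)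
    (htoggle : ∀ F ∈ K.faces \ K'.faces, ∃ v, ∀ G ∈ K.faces \ K'.faces, key G = key F →
      (insert v G ∈ K.faces \ K'.faces ∧ key (insert v G) = key F) ∧
      (G.erase v ∈ K.faces \ K'.faces ∧ key (G.erase v) = key F)) :
    ContractibleSpace (realization K) := by
  classical
  induction h : (K.faces \ K'.faces).ncard using Nat.strong_induction_on generalizing K with
  | _ N ih =>
  by_cases hP : (K.faces \ K'.faces).Nonempty
  swap
  · have : K = K' := PreAbstractSimplicialComplex.ext
      ((Set.sdiff_eq_empty.1 (Set.not_nonempty_iff_eq_empty.1 hP)).antisymm hle)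
    exact this ▸ hK'
  -- Take F of least key, then of least size: size gives `v ∉ F`, and least key forces every face
  -- above F to share its key.
  obtain ⟨F₀, hF₀, hmin₀⟩ := Set.exists_min_image _ key (Set.toFinite _) hP
  obtain ⟨F, ⟨hF, hFkey⟩, hmin⟩ := Set.exists_min_image
    {G | G ∈ K.faces \ K'.faces ∧ key G = key F₀} Finset.card (Set.toFinite _) ⟨F₀, hF₀, rfl⟩
  obtain ⟨v, hv⟩ := htoggle F hF
  have hvF : v ∉ F := fun hvF => by
    have h1 := (hv F hF rfl).2
    have := hmin _ ⟨h1.1, h1.2.trans hFkey⟩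
    have := Finset.card_erase_lt_of_mem hvF
    omega
  have hup : ∀ τ ∈ K.faces, F ⊆ τ → τ ∈ K.faces \ K'.faces := fun τ hτ hFτ =>
    ⟨hτ, fun h' => hF.2 ((K'.isRelLowerSet_faces h').2 hFτ (K.isRelLowerSet_faces hF.1).1)⟩
  have hupkey : ∀ τ ∈ K.faces, F ⊆ τ → key τ = key F := fun τ hτ hFτ =>
    le_antisymm (hkey F hF τ (hup τ hτ hFτ) hFτ) (hFkey ▸ hmin₀ τ (hup τ hτ hFτ))
  have hsub : (deleteStar K F).faces \ K'.faces ⊆ K.faces \ K'.faces :=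
    fun τ hτ => ⟨hτ.1.1, hτ.2⟩
  refine contractibleSpace_of_deleteStar (K.isRelLowerSet_faces hF.1).1 hvF
    (fun τ hτ hFτ => (hv τ (hup τ hτ hFτ) (hupkey τ hτ hFτ)).1.1.1)
    (ih _ ?_ (deleteStar K F) ?_ ?_ ?_ rfl)
  · rw [← h]
    exact Set.ncard_lt_ncard ⟨hsub, fun h' => (h' hF).1.2 subset_rfl⟩ (Set.toFinite _)
  · exact fun τ hτ => ⟨hle hτ, fun hFτ => (hup τ (hle hτ) hFτ).2 hτ⟩
  · exact fun A hA B hB hAB => hkey A (hsub hA) B (hsub hB) hAB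
  · intro A hA
    obtain ⟨w, hw⟩ := htoggle A (hsub hA)
    -- Toggling v cannot produce a face above F since `v ∉ F`; other key classes contain no face
    -- above F.
    by_cases hk : key A = key F
    · refine ⟨v, fun G hG hGk => ?_⟩
      rw [hk] at hGk ⊢
      obtain ⟨⟨h1, h2⟩, h3, h4⟩ := hv G (hsub hG) hGk
      refine ⟨⟨⟨⟨h1.1, fun h' => hG.1.2 ?_⟩, h1.2⟩, h2⟩,
        ⟨⟨⟨h3.1, fun h' => hG.1.2 (h'.trans (Finset.erase_subset _ _))⟩, h3.2⟩, h4⟩⟩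
      exact (Finset.subset_insert_iff_of_notMem hvF).1 h'
    · refine ⟨w, fun G hG hGk => ?_⟩
      obtain ⟨⟨h1, h2⟩, h3, h4⟩ := hw G (hsub hG) hGk
      exact ⟨⟨⟨⟨h1.1, fun h' => hk (h2 ▸ hupkey _ h1.1 h')⟩, h1.2⟩, h2⟩,
        ⟨⟨⟨h3.1, fun h' => hG.1.2 (h'.trans (Finset.erase_subset _ _))⟩, h3.2⟩, h4⟩⟩


/-! ### Divisors of L(a) and their p-parts -/

lemma L_ne_zero (a : ℕ) : L a ≠ 0 := by
  unfold L
  rw [Ne, Finset.lcm_eq_zero_iff]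
  rintro ⟨x, hx, h⟩
  have := Finset.mem_Icc.1 hx
  simp only [id] at h
  omega

lemma dvd_L {a d : ℕ} (h1 : 1 ≤ d) (h2 : d ≤ a) : d ∣ L a :=
  Finset.dvd_lcm (f := id) (Finset.mem_Icc.2 ⟨h1, h2⟩)

/-- The hypothesis on `k`, in terms of a prime `p` at which the maximum `M a` is attained. -/
lemma exists_prime_mul_ordCompl_L_le {a k : ℕ} (ha : 1 < a) (hk : (L a : ℚ) / (M a : ℚ) ≤ (k : ℚ)) :
    ∃ p, p.Prime ∧ p * (L a / p ^ (L a).factorization p) ≤ k := by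
  have hne : (L a).primeFactors.Nonempty :=
    ⟨2, Nat.mem_primeFactors.2 ⟨Nat.prime_two, dvd_L (by norm_num) ha, L_ne_zero a⟩⟩
  obtain ⟨p, hp, hM⟩ := Finset.exists_mem_eq_sup _ hne
    (fun p => p ^ ((L a).factorization p - 1))
  obtain ⟨hpp, hpL, -⟩ := Nat.mem_primeFactors.1 hp
  refine ⟨p, hpp, ?_⟩
  have hM' : M a = p ^ ((L a).factorization p - 1) := hM
  have hMpos : 0 < M a := hM' ▸ pow_pos hpp.pos _
  rw [div_le_iff₀ (by exact_mod_cast hMpos)] at hk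
  have hk' : L a ≤ k * M a := by exact_mod_cast hk
  refine Nat.le_of_mul_le_mul_right ?_ hMpos
  refine le_trans (le_of_eq ?_) hk'
  have hα : 1 ≤ (L a).factorization p := hpp.factorization_pos_of_dvd (L_ne_zero a) hpL
  conv_rhs => rw [← Nat.ordProj_mul_ordCompl_eq_self (L a) p]
  rw [hM', mul_right_comm, ← pow_succ', Nat.sub_add_cancel hα]

/-- The p-free part of X divides that of `L a`, so p times it is at most k. -/
lemma le_mul_of_dvd_L {a k p m X : ℕ} (hp : p * (L a / p ^ (L a).factorization p) ≤ k)
    (hX : X ∣ L a) (hXm : p ^ X.factorization p ≤ m * p) : X ≤ k * m := by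
  have h1 : X / p ^ X.factorization p ≤ L a / p ^ (L a).factorization p :=
    Nat.le_of_dvd (Nat.ordCompl_pos p (L_ne_zero a)) (Nat.ordCompl_dvd_ordCompl_of_dvd hX p)
  calc X = p ^ X.factorization p * (X / p ^ X.factorization p) :=
        (Nat.ordProj_mul_ordCompl_eq_self X p).symm
    _ ≤ (m * p) * (L a / p ^ (L a).factorization p) := Nat.mul_le_mul hXm h1
    _ = (p * (L a / p ^ (L a).factorization p)) * m := by ring
    _ ≤ k * m := Nat.mul_le_mul_right _ hp

/-- One of a and a - 1 is prime to p, and p times it is at most k; moreover 2 (a - 1) ≥ a. -/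
lemma le_of_mul_ordCompl_L_le {a k p : ℕ} (ha : 1 < a) (hpp : p.Prime)
    (hp : p * (L a / p ^ (L a).factorization p) ≤ k) : a ≤ k := by
  have key : ∀ d, 1 ≤ d → d ≤ a → ¬ p ∣ d → p * d ≤ k := fun d h1 h2 h3 => by
    refine le_trans (Nat.mul_le_mul_left p ?_) hp
    have := Nat.ordCompl_dvd_ordCompl_of_dvd (dvd_L h1 h2) p
    rw [Nat.factorization_eq_zero_of_not_dvd h3, pow_zero, Nat.div_one] at this
    exact Nat.le_of_dvd (Nat.ordCompl_pos p (L_ne_zero a)) this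
  have h2 := hpp.two_le
  by_cases h : p ∣ a
  · have h' : ¬ p ∣ a - 1 := fun h' => by
      have := (Nat.dvd_sub h h')
      rw [Nat.sub_sub_self ha.le] at this
      exact hpp.one_lt.ne' (Nat.dvd_one.1 this)
    have := key (a - 1) (by omega) (by omega) h'
    nlinarith [Nat.sub_add_cancel ha.le]
  · have := key a ha.le le_rfl h
    nlinarith

lemma pow_factorization_lcm_le {p D : ℕ} (hD : 1 ≤ D) {S : Finset ℕ}
    (hS : ∀ d ∈ S, 1 ≤ d ∧ d ≤ D) : p ^ (S.lcm id).factorization p ≤ D := by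
  classical
  induction S using Finset.induction_on with
  | empty => simpa using hD
  | insert d S _ ih =>
    have hd := hS d (Finset.mem_insert_self _ _)
    have hS' : ∀ e ∈ S, 1 ≤ e ∧ e ≤ D := fun e he => hS e (Finset.mem_insert_of_mem he)
    have h0 : S.lcm id ≠ 0 := by
      rw [Ne, Finset.lcm_eq_zero_iff]
      rintro ⟨x, hx, h⟩
      have := hS' x hx
      simp only [id] at h
      omega
    rw [Finset.lcm_insert]
    have : (lcm (id d) (S.lcm id)).factorization p
        = max (d.factorization p) ((S.lcm id).factorization p) := by
      rw [lcm_eq_nat_lcm, Nat.factorization_lcm (by simp; omega) h0]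
      rfl
    rw [this]
    rcases max_choice (d.factorization p) ((S.lcm id).factorization p) with h | h <;> rw [h]
    · exact (Nat.ordProj_le p (by omega)).trans hd.2
    · exact ih hS'

/-- Among the differences in `(m, D]` there is one that can be joined to any set of differences
without raising the least common multiple above the bound `k * m`. -/
lemma exists_apex {a k p m D : ℕ} (hpp : p.Prime)
    (hp : p * (L a / p ^ (L a).factorization p) ≤ k) (hm : 1 ≤ m) (hmD : m < D) (hDa : D ≤ a) :
    ∃ c, m < c ∧ c ≤ D ∧ ∀ S : Finset ℕ, (∀ d ∈ S, 1 ≤ d ∧ d ≤ D) →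
      Nat.lcm (S.lcm id) c = S.lcm id ∨ Nat.lcm (S.lcm id) c ≤ k * m := by
  have hSL : ∀ S : Finset ℕ, (∀ d ∈ S, 1 ≤ d ∧ d ≤ D) → S.lcm id ∣ L a := fun S hS =>
    Finset.lcm_dvd fun d hd => dvd_L (hS d hd).1 ((hS d hd).2.trans hDa)
  have hlt : m < p ^ (Nat.log p m + 1) := Nat.lt_pow_succ_log_self hpp.one_lt m
  have hle : p ^ (Nat.log p m + 1) ≤ m * p := by
    rw [pow_succ]
    exact Nat.mul_le_mul_right _ (Nat.pow_log_le_self p (by omega))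
  -- The least power of p above m: if it does not divide the lcm, it becomes the exact p-part after
  -- joining.
  by_cases hc : p ^ (Nat.log p m + 1) ≤ D
  · refine ⟨_, hlt, hc, fun S hS => ?_⟩
    have h0 : S.lcm id ≠ 0 := ne_zero_of_dvd_ne_zero (L_ne_zero a) (hSL S hS)
    by_cases h : p ^ (Nat.log p m + 1) ∣ S.lcm id
    · exact Or.inl (Nat.lcm_eq_left h)
    · right
      refine le_mul_of_dvd_L hp
        (Nat.lcm_dvd (hSL S hS) (dvd_L (by omega) (hc.trans hDa))) ?_
      rw [Nat.factorization_lcm h0 (pow_pos hpp.pos _).ne', Finsupp.sup_apply,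
        hpp.factorization_pow, Finsupp.single_eq_same, sup_eq_right.2]
      · exact hle
      · by_contra hcon
        exact h ((hpp.pow_dvd_iff_le_factorization h0).2 (by omega))
  -- No power of p lies in (m, D], so all p-parts are already below m p and any choice in (m, D]
  -- would do.
  · refine ⟨m + 1, by omega, hmD, fun S hS => Or.inr ?_⟩
    have hS' : ∀ d ∈ insert (m + 1) S, 1 ≤ d ∧ d ≤ D := by
      intro d hd
      rcases Finset.mem_insert.1 hd with rfl | hd
      · omega
      · exact hS d hd
    have : Nat.lcm (S.lcm id) (m + 1) = (insert (m + 1) S).lcm id := by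
      rw [Finset.lcm_insert, lcm_eq_nat_lcm, Nat.lcm_comm]; rfl
    rw [this]
    refine le_mul_of_dvd_L hp (hSL _ hS') ?_
    have := pow_factorization_lcm_le (p := p) (by omega) hS'
    omega


/-! ### Faces with a fixed maximum: levels and toggles -/

/-- `z ≥ 1` lies in the progression with `k` steps of size `d` that ends in `n`. -/
def Reaches (n k d z : ℕ) : Prop := 1 ≤ z ∧ z ≤ n ∧ d ∣ n - z ∧ n - z ≤ k * d

/-- `F` contains `n` and lies in a progression with `k` steps ending in `n` whose difference
is at most `D`. -/
def InLink (n k D : ℕ) (F : Finset ℕ) : Prop :=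
  n ∈ F ∧ ∃ d, 1 ≤ d ∧ d ≤ D ∧ ∀ z ∈ F, Reaches n k d z

/-- Take y = n - lcm(S, c), with S the differences in [t, D] reaching z; the bound k t on the lcm is
at most k d for each d ≥ t. -/
lemma exists_reaches_of_lcm_le {n k D t c z : ℕ} (hn : 2 ≤ n) (ht : 1 ≤ t) (htc : t ≤ c)
    (hz : ¬ Reaches n k c z) (hz1 : 1 ≤ z) (hzn : z ≤ n)
    (h : ∀ S : Finset ℕ, (∀ d ∈ S, t ≤ d ∧ d ≤ D) → S.lcm id ∣ n - z → S.lcm id ≤ n - z →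
      Nat.lcm (S.lcm id) c ≤ n - 1 ∧ Nat.lcm (S.lcm id) c ≤ k * t) :
    ∃ y, Reaches n k c y ∧ y < n ∧ ∀ d, t ≤ d → d ≤ D → Reaches n k d z → Reaches n k d y := by
  classical
  have hzn' : z < n := by
    refine lt_of_le_of_ne hzn fun h => hz ?_
    subst h
    exact ⟨hz1, le_rfl, by simp, by simp⟩
  set S := (Finset.Icc t D).filter fun d => Reaches n k d z with hS
  have hSt : ∀ d ∈ S, t ≤ d ∧ d ≤ D := fun d hd => Finset.mem_Icc.1 (Finset.mem_filter.1 hd).1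
  have hdvd : S.lcm id ∣ n - z :=
    Finset.lcm_dvd fun d hd => (Finset.mem_filter.1 hd).2.2.2.1
  obtain ⟨h1, h2⟩ := h S hSt hdvd (Nat.le_of_dvd (by omega) hdvd)
  have hpos : 0 < Nat.lcm (S.lcm id) c :=
    Nat.lcm_pos (Nat.pos_of_dvd_of_pos hdvd (by omega)) (by omega)
  have key : ∀ d, t ≤ d → d ∣ Nat.lcm (S.lcm id) c →
      Reaches n k d (n - Nat.lcm (S.lcm id) c) := fun d htd hd => by
    have e : n - (n - Nat.lcm (S.lcm id) c) = Nat.lcm (S.lcm id) c := by omega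
    refine ⟨by omega, by omega, by rwa [e], ?_⟩
    rw [e]
    exact h2.trans (Nat.mul_le_mul_left k htd)
  refine ⟨n - Nat.lcm (S.lcm id) c, key c htc (Nat.dvd_lcm_right _ _), by omega,
    fun d h3 h4 h5 => key d h3 ?_⟩
  exact (Finset.dvd_lcm (f := id) (Finset.mem_filter.2 ⟨Finset.mem_Icc.2 ⟨h3, h4⟩, h5⟩)).trans
    (Nat.dvd_lcm_left _ _)

variable {a k p : ℕ}

lemma exists_dominating {n D t : ℕ} (hpp : p.Prime)
    (hp : p * (L a / p ^ (L a).factorization p) ≤ k) (hn : 2 ≤ n) (hDa : D ≤ a)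
    (ht : 1 ≤ t) (htD : t < D) (htn : k * t ≤ n - 1) :
    ∃ c, t < c ∧ c ≤ D ∧ ∀ z, Reaches n k t z → ¬ Reaches n k c z →
      ∃ y, Reaches n k c y ∧ y < n ∧
        ∀ d, t ≤ d → d ≤ D → Reaches n k d z → Reaches n k d y := by
  obtain ⟨c, hc1, hc2, hc⟩ := exists_apex hpp hp ht htD hDa
  refine ⟨c, hc1, hc2, fun z hz hzc =>
    exists_reaches_of_lcm_le hn ht hc1.le hzc hz.1 hz.2.1 fun S hS hSz hle => ?_⟩
  have h1 := hz.1
  have h2 := hz.2.2.2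
  rcases hc S fun d hd => ⟨ht.trans (hS d hd).1, (hS d hd).2⟩ with h | h <;> omega

/-- Either q = D - 1 and only D remains, or k (q + 1) > n - 1 and the size bound in `Reaches` is
automatic. -/
lemma exists_dominating_top {n D q : ℕ} (hpp : p.Prime)
    (hp : p * (L a / p ^ (L a).factorization p) ≤ k) (hk : 1 ≤ k) (hn : 2 ≤ n) (hDa : D ≤ a)
    (hD : 1 ≤ D) (hq : q = min ((n - 1) / k) (D - 1)) :
    ∃ c, q + 1 ≤ c ∧ c ≤ D ∧ (∃ w, Reaches n k c w ∧ w < n) ∧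
      ∀ z, (∃ d, q + 1 ≤ d ∧ d ≤ D ∧ Reaches n k d z) → ¬ Reaches n k c z →
      ∃ y, Reaches n k c y ∧ y < n ∧
        ∀ d, q + 1 ≤ d → d ≤ D → Reaches n k d z → Reaches n k d y := by
  have hw : ∀ c, 1 ≤ c → c ≤ n - 1 → ∃ w, Reaches n k c w ∧ w < n := fun c h1 h2 => by
    have e : n - (n - c) = c := by omega
    exact ⟨n - c, ⟨by omega, by omega, by rw [e], by rw [e]; exact Nat.le_mul_of_pos_left c hk⟩,
      by omega⟩
  have hdm := Nat.div_add_mod (n - 1) k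
  have hml := Nat.mod_lt (n - 1) hk
  rcases Nat.eq_zero_or_pos q with h0 | h0
  · subst h0
    refine ⟨1, by omega, hD, hw 1 le_rfl (by omega), ?_⟩
    rintro z ⟨d, h1, h2, h3⟩ h4
    exfalso
    rcases min_choice ((n - 1) / k) (D - 1) with h | h
    · rw [h] at hq
      rw [← hq] at hdm
      have := h3.1
      exact h4 ⟨h3.1, h3.2.1, one_dvd _, by omega⟩
    · have : d = 1 := by omega
      exact h4 (this ▸ h3)
  · obtain ⟨c, hc1, hc2, hc⟩ := exists_apex (D := D) hpp hp h0 (by omega) hDa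
    have hkq : k * q ≤ n - 1 := by
      have : q ≤ (n - 1) / k := by omega
      exact (Nat.mul_le_mul_left k this).trans (Nat.mul_div_le _ _)
    refine ⟨c, hc1, hc2, hw c (by omega) ?_, ?_⟩
    -- The empty set has lcm 1, so the alternatives bound c itself.
    · rcases hc ∅ (by simp) with h | h <;> simp at h <;> omega
    rintro z ⟨d, h1, h2, h3⟩ h4
    refine exists_reaches_of_lcm_le hn (by omega) hc1 h4 h3.1 h3.2.1 fun S hS hSz hle => ?_
    have hdc : d ≠ c := fun h => h4 (h ▸ h3)
    have hq' : q = (n - 1) / k := by omega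
    have hn1 : n - 1 < k * (q + 1) := by rw [hq', mul_add]; omega
    have := h3.1
    have := h3.2.1
    rcases hc S fun e he => ⟨by have := (hS e he).1; omega, (hS e he).2⟩ with h | h <;> omega

/-- For every `n ≥ 2`, the sets in the link of `n` (with `n` added) carry a key such that for every
value of the key there is a vertex that can be added and removed. -/
theorem exists_key_inLink {n D : ℕ} (hpp : p.Prime)
    (hp : p * (L a / p ^ (L a).factorization p) ≤ k) (hk : 1 ≤ k) (hn : 2 ≤ n) (hDa : D ≤ a)
    (hD : 1 ≤ D) :
    ∃ key : Finset ℕ → ℕ ×ₗ WithTop ℕ,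
      (∀ F G, InLink n k D F → InLink n k D G → F ⊆ G → key G ≤ key F) ∧
      ∀ F, InLink n k D F → ∃ v, 1 ≤ v ∧ v < n ∧ ∀ G, InLink n k D G → key G = key F →
        (InLink n k D (insert v G) ∧ key (insert v G) = key F) ∧
        (InLink n k D (G.erase v) ∧ key (G.erase v) = key F) := by
  classical
  obtain ⟨q, hq⟩ : ∃ q, q = min ((n - 1) / k) (D - 1) := ⟨_, rfl⟩
  have hkq : ∀ t ≤ q, k * t ≤ n - 1 := fun t ht =>
    (Nat.mul_le_mul_left k (ht.trans (by omega : q ≤ (n - 1) / k))).trans (Nat.mul_div_le _ _)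
  have hqD : q < D := by omega
  -- the apex for each level
  have hex : ∀ t, ∃ c, 1 ≤ t → t ≤ q + 1 → t ≤ c ∧ c ≤ D ∧ (t ≤ q → t < c) ∧
      (t = q + 1 → ∃ w, Reaches n k c w ∧ w < n) ∧
      ∀ z, (∃ d, t ≤ d ∧ d ≤ D ∧ Reaches n k d z) → (t ≤ q → Reaches n k t z) →
        ¬ Reaches n k c z → ∃ y, Reaches n k c y ∧ y < n ∧
        ∀ d, t ≤ d → d ≤ D → Reaches n k d z → Reaches n k d y := by
    intro t
    by_cases ht : 1 ≤ t ∧ t ≤ q + 1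
    · rcases Nat.lt_or_ge q t with h | h
      · obtain rfl : t = q + 1 := by omega
        obtain ⟨c, h1, h2, h3, h4⟩ := exists_dominating_top hpp hp hk hn hDa hD hq
        exact ⟨c, fun _ _ => ⟨h1, h2, fun _ => by omega, fun _ => h3, fun z hz _ => h4 z hz⟩⟩
      · obtain ⟨c, h1, h2, h3⟩ :=
          exists_dominating hpp hp hn hDa ht.1 (h.trans_lt hqD) (hkq t h)
        exact ⟨c, fun _ _ => ⟨h1.le, h2, fun _ => h1, fun _ => by omega,
          fun z _ hz => h3 z (hz h)⟩⟩
    · exact ⟨0, fun h1 h2 => absurd ⟨h1, h2⟩ ht⟩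
  choose c hc using hex
  let P : Finset ℕ → ℕ → Prop := fun F t => ∃ d, t ≤ d ∧ d ≤ D ∧ ∀ z ∈ F, Reaches n k d z
  let lev : Finset ℕ → ℕ := fun F => Nat.findGreatest (P F) (q + 1)
  -- The value is `⊤` exactly when `c t` reaches all of F.
  let rest : ℕ → Finset ℕ → WithTop ℕ := fun t F =>
    (F.filter fun z => ¬ Reaches n k (c t) z).min
  have hP1 : ∀ {F}, InLink n k D F → P F 1 := fun h => h.2
  have hlev1 : ∀ {F}, InLink n k D F → 1 ≤ lev F := fun h =>
    Nat.le_findGreatest (by omega) (hP1 h)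
  have hlevP : ∀ {F}, InLink n k D F → P F (lev F) := fun h =>
    Nat.findGreatest_spec (P := P _) (m := 1) (by omega) (hP1 h)
  have hlevq : ∀ F, lev F ≤ q + 1 := fun F => Nat.findGreatest_le _
  have hPmono : ∀ {F G t}, F ⊆ G → P G t → P F t := fun hFG ⟨d, h1, h2, h3⟩ =>
    ⟨d, h1, h2, fun z hz => h3 z (hFG hz)⟩
  have hlevmono : ∀ {F G}, F ⊆ G → InLink n k D G → lev G ≤ lev F := fun hFG hG =>
    Nat.le_findGreatest (hlevq _) (hPmono hFG (hlevP hG))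
  have hlevmax : ∀ {F t}, lev F < t → t ≤ q + 1 → ¬ P F t := fun h1 h2 =>
    Nat.findGreatest_is_greatest h1 h2
  have hlink : ∀ {F t}, n ∈ F → 1 ≤ t → P F t → InLink n k D F := fun h1 h2 ⟨d, h3, h4, h5⟩ =>
    ⟨h1, d, h2.trans h3, h4, h5⟩
  have hlevI : ∀ {F t}, t ≤ q + 1 → P F t → (∀ s, t < s → s ≤ q + 1 → ¬ P F s) → lev F = t :=
    fun h1 h2 h3 => by
      refine le_antisymm ?_ (Nat.le_findGreatest h1 h2)
      by_contra h
      have h4 := Nat.findGreatest_spec (P := P _) h1 h2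
      exact h3 _ (not_le.1 h) (hlevq _) h4
  refine ⟨fun F => toLex (lev F, rest (lev F) F), fun F G hF hG hFG => ?_, fun F hF => ?_⟩
  · rw [Prod.Lex.toLex_le_toLex]
    rcases (hlevmono hFG hG).lt_or_eq with h | h
    · exact Or.inl h
    · refine Or.inr ⟨h, ?_⟩
      simp only [h]
      exact Finset.min_mono (Finset.filter_subset_filter _ hFG)
  obtain ⟨t, ht⟩ : ∃ t, lev F = t := ⟨_, rfl⟩
  have ht1 : 1 ≤ t := ht ▸ hlev1 hF
  have htq : t ≤ q + 1 := ht ▸ hlevq F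
  obtain ⟨hc1, hc2, hc3, hc4, hc5⟩ := hc t ht1 htq
  -- toggling an element reached by `c t`, when this does not change the level
  have hmain : ∀ v, Reaches n k (c t) v → v < n →
      (∀ G, InLink n k D G → lev G = t → rest t G = rest t F →
        P (insert v G) t ∧ ∀ s, t < s → s ≤ q + 1 → ¬ P (G.erase v) s) →
      ∃ v, 1 ≤ v ∧ v < n ∧ ∀ G, InLink n k D G →
        toLex (lev G, rest (lev G) G) = toLex (lev F, rest (lev F) F) →
        (InLink n k D (insert v G) ∧ toLex (lev (insert v G), rest (lev (insert v G)) (insert v G))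
          = toLex (lev F, rest (lev F) F)) ∧
        (InLink n k D (G.erase v) ∧ toLex (lev (G.erase v), rest (lev (G.erase v)) (G.erase v))
          = toLex (lev F, rest (lev F) F)) := by
    intro v hv hvn hG
    refine ⟨v, hv.1, hvn, fun G hGl hGk => ?_⟩
    obtain ⟨hGt, hGr⟩ := Prod.ext_iff.1 (toLex.injective hGk)
    simp only [ht] at hGt
    simp only [ht, hGt] at hGr
    obtain ⟨h1, h2⟩ := hG G hGl hGt hGr
    have hPG : P G t := hGt ▸ hlevP hGl
    have hins : lev (insert v G) = t := hlevI htq h1 fun s hs hsq hPs =>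
      hlevmax (hGt ▸ hs) hsq (hPmono (Finset.subset_insert v G) hPs)
    have hera : lev (G.erase v) = t := hlevI htq (hPmono (Finset.erase_subset v G) hPG) h2
    refine ⟨⟨hlink (Finset.mem_insert_of_mem hGl.1) ht1 h1, ?_⟩,
      ⟨hlink (Finset.mem_erase.2 ⟨hvn.ne', hGl.1⟩) ht1 (hPmono (Finset.erase_subset v G) hPG), ?_⟩⟩
    · rw [hins, ht, ← hGr]
      simp only [rest]
      rw [Finset.filter_insert, if_neg (not_not.2 hv)]
    · rw [hera, ht, ← hGr]
      simp only [rest]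
      rw [Finset.filter_erase, Finset.erase_eq_of_notMem]
      simp [hv]
  by_cases hr : ∃ x, x ∈ F.filter fun z => ¬ Reaches n k (c t) z
  · obtain ⟨x, hx⟩ := Finset.min_of_nonempty hr
    have hxF := Finset.mem_filter.1 (Finset.mem_of_min hx)
    have hxG : ∀ {G}, rest t G = rest t F → x ∈ G := fun h =>
      (Finset.mem_filter.1 (Finset.mem_of_min (h.trans hx))).1
    have hexact : ∀ {G}, InLink n k D G → lev G = t → t ≤ q → ∀ z ∈ G, Reaches n k t z := by
      intro G hG hGt htq' z hz
      obtain ⟨d, h1, h2, h3⟩ := hlevP hG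
      rw [hGt] at h1
      rcases h1.lt_or_eq with h | h
      · exact absurd ⟨d, h, h2, h3⟩ (hlevmax (F := G) (t := t + 1) (by omega) (by omega))
      · exact h ▸ h3 z hz
    obtain ⟨d, hd1, hd2, hd3⟩ := hlevP hF
    obtain ⟨y, hy1, hy2, hy3⟩ := hc5 x ⟨d, ht ▸ hd1, hd2, hd3 x hxF.1⟩
      (fun h => hexact hF ht h x hxF.1) hxF.2
    -- Since x stays in G, a difference ≥ t reaching the rest of G reaches y as well.
    refine hmain y hy1 hy2 fun G hGl hGt hGr => ⟨?_, fun s hs hsq hPs => ?_⟩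
    · obtain ⟨e, he1, he2, he3⟩ := hlevP hGl
      rw [hGt] at he1
      refine ⟨e, he1, he2, fun z hz => ?_⟩
      rcases Finset.mem_insert.1 hz with rfl | hz
      · exact hy3 e he1 he2 (he3 x (hxG hGr))
      · exact he3 z hz
    · obtain ⟨e, he1, he2, he3⟩ := hPs
      have hxy : x ≠ y := fun h => hxF.2 (h ▸ hy1)
      refine hlevmax (hGt ▸ hs) hsq ⟨e, he1, he2, fun z hz => ?_⟩
      by_cases hzy : z = y
      · exact hzy ▸ hy3 e (by omega) he2 (he3 x (Finset.mem_erase.2 ⟨hxy, hxG hGr⟩))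
      · exact he3 z (Finset.mem_erase.2 ⟨hzy, hz⟩)
  · have hall : ∀ {G}, rest t G = rest t F → ∀ z ∈ G, Reaches n k (c t) z := by
      intro G hG z hz
      have h1 : F.filter (fun z => ¬ Reaches n k (c t) z) = ∅ :=
        Finset.eq_empty_of_forall_notMem fun z hz => hr ⟨z, hz⟩
      have h2 : rest t G = ⊤ := by rw [hG]; simp only [rest]; rw [h1, Finset.min_empty]
      have h3 := Finset.min_eq_top.1 h2
      by_contra h
      exact Finset.notMem_empty z (h3 ▸ Finset.mem_filter.2 ⟨hz, h⟩)
    -- Below the cap, `c t > t` reaching all of F would raise the level.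
    have htop : t = q + 1 := by
      by_contra h
      have hlt := hc3 (by omega)
      exact hlevmax (F := F) (t := t + 1) (by omega) (by omega) ⟨c t, hlt, hc2, hall rfl⟩
    obtain ⟨w, hw1, hw2⟩ := hc4 htop
    refine hmain w hw1 hw2 fun G hGl hGt hGr => ⟨⟨c t, hc1, hc2, fun z hz => ?_⟩,
      fun s hs hsq => by omega⟩
    rcases Finset.mem_insert.1 hz with rfl | hz
    · exact hw1
    · exact hall hGr z hz


/-! ### Admissible differences for a given maximum -/

/-- The largest `d` for which the residue class of `n` modulo `d` contains a progression with
`k` steps inside `{1, …, N}`. -/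
def maxDiff (N k n : ℕ) : ℕ := Nat.findGreatest (fun d => (n - 1) % d + 1 + k * d ≤ N) N

section maxDiff

variable {a N k n : ℕ}

lemma one_le_maxDiff (hkN : k < N) : 1 ≤ maxDiff N k n :=
  Nat.le_findGreatest (by omega) (by simp [Nat.mod_one]; omega)

lemma maxDiff_spec (hkN : k < N) :
    (n - 1) % maxDiff N k n + 1 + k * maxDiff N k n ≤ N :=
  Nat.findGreatest_spec (P := fun d => (n - 1) % d + 1 + k * d ≤ N) (m := 1) (by omega)
    (by simp [Nat.mod_one]; omega)

lemma maxDiff_le (hkN : k < N) (hN : N ≤ (a + 1) * k) : maxDiff N k n ≤ a := by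
  have h := maxDiff_spec (n := n) hkN
  by_contra hcon
  have : k * (a + 1) ≤ k * maxDiff N k n := Nat.mul_le_mul_left k (by omega)
  rw [mul_comm] at hN
  omega

lemma le_maxDiff {d : ℕ} (hk : 1 ≤ k) (h : (n - 1) % d + 1 + k * d ≤ N) : d ≤ maxDiff N k n := by
  refine Nat.le_findGreatest ?_ h
  have := Nat.le_mul_of_pos_left d hk
  omega

/-- For d below the maximum, d ≤ a ≤ k, so passing from k d to k (d + 1) absorbs the residue. -/
lemma add_le_of_le_maxDiff {d : ℕ} (hkN : k < N) (hN : N ≤ (a + 1) * k) (hak : a ≤ k)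
    (hd : 1 ≤ d) (h : d ≤ maxDiff N k n) : (n - 1) % d + 1 + k * d ≤ N := by
  have h1 := maxDiff_spec (n := n) hkN
  rcases h.lt_or_eq with h | h
  · have h2 := maxDiff_le (n := n) hkN hN
    have h3 : k * (d + 1) ≤ k * maxDiff N k n := Nat.mul_le_mul_left k h
    have h4 := Nat.mod_lt (n - 1) hd
    rw [mul_add] at h3
    omega
  · rwa [h]

end maxDiff

lemma mem_progression {x d k z : ℕ} : z ∈ progression x d k ↔ ∃ i ≤ k, x + i * d = z := by
  simp [progression]

/-- The progression may be slid along its residue class: to end at n if 1 + k d ≤ n, otherwise to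
start at the least positive element of the class. -/
theorem exists_progression_iff_inLink {a N k n : ℕ} {F : Finset ℕ} (hk : 1 ≤ k) (hkN : k < N)
    (hN : N ≤ (a + 1) * k) (hak : a ≤ k) (hF : ∀ z ∈ F, 1 ≤ z ∧ z ≤ n) (hn : n ∈ F) (hnN : n ≤ N) :
    (∃ x d : ℕ, 0 < d ∧ 1 ≤ x ∧ x < x + k * d ∧ x + k * d ≤ N ∧ F ⊆ progression x d k) ↔
      InLink n k (maxDiff N k n) F := by
  constructor
  · rintro ⟨x, d, hd, hx, -, hxN, hsub⟩
    obtain ⟨j, hj, hjn⟩ := mem_progression.1 (hsub hn)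
    refine ⟨hn, d, hd, le_maxDiff hk ?_, fun z hz => ?_⟩
    · have : (n - 1) % d = (x - 1) % d := by
        rw [show n - 1 = x - 1 + j * d by omega, Nat.add_mul_mod_self_right]
      have := Nat.mod_le (x - 1) d
      omega
    · obtain ⟨i, hi, hiz⟩ := mem_progression.1 (hsub hz)
      obtain ⟨h1, h2⟩ := hF z hz
      have e : n - z = (j - i) * d := by rw [Nat.sub_mul]; omega
      exact ⟨h1, h2, e ▸ Dvd.intro_left _ rfl, e ▸ Nat.mul_le_mul_right d (by omega)⟩
  · rintro ⟨-, d, hd, hdD, hR⟩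
    have hadd := add_le_of_le_maxDiff hkN hN hak hd hdD
    have hkd : 0 < k * d := Nat.mul_pos hk hd
    have main : ∀ x, 1 ≤ x → x + k * d ≤ N → n ≤ x + k * d →
        (∀ z ∈ F, x ≤ z ∧ d ∣ z - x) → ∃ x d : ℕ, 0 < d ∧ 1 ≤ x ∧ x < x + k * d ∧
          x + k * d ≤ N ∧ F ⊆ progression x d k := by
      refine fun x hx hxN hnx h => ⟨x, d, hd, hx, by omega, hxN, fun z hz => ?_⟩
      obtain ⟨h1, i, h2⟩ := h z hz
      have h3 := (hF z hz).2
      rw [mul_comm] at h2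
      refine mem_progression.2 ⟨i, ?_, by omega⟩
      exact Nat.le_of_mul_le_mul_right (by omega : i * d ≤ k * d) hd
    by_cases h : 1 + k * d ≤ n
    · refine main (n - k * d) (by omega) (by omega) (by omega) fun z hz => ?_
      obtain ⟨h1, h2, h3, h4⟩ := hR z hz
      refine ⟨by omega, ?_⟩
      have := Nat.dvd_sub (Dvd.intro_left k rfl : d ∣ k * d) h3
      rwa [show k * d - (n - z) = z - (n - k * d) by omega] at this
    · refine main ((n - 1) % d + 1) (by omega) (by omega) (by omega) fun z hz => ?_
      obtain ⟨h1, h2, h3, h4⟩ := hR z hz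
      have e : (n - 1) % d = (z - 1) % d := by
        obtain ⟨i, hi⟩ := h3
        rw [show n - 1 = z - 1 + d * i by omega, Nat.add_mul_mod_self_left]
      have := Nat.mod_le (z - 1) d
      refine ⟨by omega, ?_⟩
      rw [e, show z - ((z - 1) % d + 1) = z - 1 - (z - 1) % d by omega]
      exact Nat.dvd_sub_mod _

/-! ### Reduction to the vertex 1 -/

/-- The simplicial complex whose only face is `{v}`. -/
def point {V : Type*} (v : V) : PreAbstractSimplicialComplex V where
  faces := {{v}}
  isRelLowerSet_faces := by
    rintro F rfl
    exact ⟨Finset.singleton_nonempty v, fun G hG hne => hne.subset_singleton_iff.1 hG⟩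

lemma contractibleSpace_point {V : Type*} [Fintype V] [DecidableEq V] (v : V) :
    ContractibleSpace (realization (point v)) := by
  have h : ∀ f ∈ realization (point v), f = Pi.single v 1 := by
    rintro f ⟨hf, s, rfl, hs⟩
    have h0 : ∀ w, w ≠ v → f w = 0 := fun w hw => hs w (by simpa using hw)
    have h1 : f v = 1 := by
      rw [← hf.2]
      exact (Finset.sum_eq_single v (fun w _ hw => h0 w hw) (by simp)).symm
    funext w
    by_cases hw : w = v
    · subst hw; simp [h1]
    · simp [h0 w hw, hw]
  have hmem : (Pi.single v 1 : V → ℝ) ∈ realization (point v) :=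
    ⟨single_mem_stdSimplex ℝ v, {v}, rfl, fun w hw => by
      rw [Finset.mem_singleton] at hw; simp [hw]⟩
  have : Nonempty (realization (point v)) := ⟨⟨_, hmem⟩⟩
  have : Subsingleton (realization (point v)) :=
    ⟨fun x y => Subtype.ext ((h x.1 x.2).trans (h y.1 y.2).symm)⟩
  infer_instance

theorem contractibleSpace_realization_vdW (a k n : ℕ) (ha : 1 < a)
    (hk : (L a : ℚ) / (M a : ℚ) ≤ (k : ℚ))
    (hkn : k < n) (hn : n ≤ (a + 1) * k) :
    ContractibleSpace (realization (vdW n k)) := by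
  classical
  obtain ⟨p, hpp, hp⟩ := exists_prime_mul_ordCompl_L_le ha hk
  have hak := le_of_mul_ordCompl_L_le ha hpp hp
  have hk1 : 1 ≤ k := by omega
  let val : Finset (Finset.Icc 1 n) → Finset ℕ := fun F => F.map (Function.Embedding.subtype _)
  let top : Finset (Finset.Icc 1 n) → ℕ := fun F => (val F).sup id
  have hval : ∀ F, ∀ z ∈ val F, 1 ≤ z ∧ z ≤ top F := by
    intro F z hz
    obtain ⟨w, -, rfl⟩ := Finset.mem_map.1 hz
    exact ⟨(Finset.mem_Icc.1 w.2).1, Finset.le_sup (f := id) hz⟩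
  have htopn : ∀ F, top F ≤ n := by
    intro F
    refine Finset.sup_le fun z hz => ?_
    obtain ⟨w, -, rfl⟩ := Finset.mem_map.1 hz
    exact (Finset.mem_Icc.1 w.2).2
  have htopm : ∀ F, F.Nonempty → top F ∈ val F := by
    intro F hF
    obtain ⟨z, hz, h⟩ := Finset.exists_mem_eq_sup (val F) (hF.map) id
    exact (show top F = z from h) ▸ hz
  have htopI : ∀ F m, m ∈ val F → (∀ z ∈ val F, z ≤ m) → top F = m := fun F m h1 h2 =>
    le_antisymm (Finset.sup_le h2) (Finset.le_sup (f := id) h1)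
  let one : Finset.Icc 1 n := ⟨1, Finset.mem_Icc.2 ⟨le_rfl, by omega⟩⟩
  -- faces other than `{1}`
  have hface : ∀ F, F ∈ (vdW n k).faces \ (point one).faces ↔
      2 ≤ top F ∧ InLink (top F) k (maxDiff n k (top F)) (val F) := by
    intro F
    constructor
    · rintro ⟨⟨hne, hF⟩, hF1⟩
      refine ⟨?_, (exists_progression_iff_inLink hk1 hkn hn hak (hval F) (htopm F hne)
        (htopn F)).1 hF⟩
      by_contra hlt
      refine hF1 (Finset.eq_singleton_iff_nonempty_unique_mem.2 ⟨hne, fun w hw => ?_⟩)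
      have := hval F w (Finset.mem_map_of_mem _ hw)
      exact Subtype.ext (show (w : ℕ) = 1 by omega)
    · rintro ⟨h2, hF⟩
      have hne : F.Nonempty := Finset.map_nonempty.1 ⟨_, hF.1⟩
      refine ⟨⟨hne, (exists_progression_iff_inLink hk1 hkn hn hak (hval F) (htopm F hne)
        (htopn F)).2 hF⟩, ?_⟩
      rintro rfl
      have : top {one} = 1 := by simp [top, val, one]
      omega
  have hex : ∀ m, ∃ key : Finset ℕ → ℕ ×ₗ WithTop ℕ, 2 ≤ m →
      (∀ F G, InLink m k (maxDiff n k m) F → InLink m k (maxDiff n k m) G → F ⊆ G →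
        key G ≤ key F) ∧
      ∀ F, InLink m k (maxDiff n k m) F → ∃ v, 1 ≤ v ∧ v < m ∧
        ∀ G, InLink m k (maxDiff n k m) G → key G = key F →
        (InLink m k (maxDiff n k m) (insert v G) ∧ key (insert v G) = key F) ∧
        (InLink m k (maxDiff n k m) (G.erase v) ∧ key (G.erase v) = key F) := by
    intro m
    by_cases hm : 2 ≤ m
    · obtain ⟨key, h⟩ := exists_key_inLink hpp hp hk1 hm (maxDiff_le (n := m) hkn hn)
        (one_le_maxDiff hkn)
      exact ⟨key, fun _ => h⟩
    · exact ⟨fun _ => toLex (0, 0), fun h => absurd h hm⟩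
  choose key hkey using hex
  refine contractibleSpace_of_key
    -- Subtracting from n makes the key antitone in the maximum.
    (fun F => (toLex (n - top F, key (top F) (val F)) : ℕ ×ₗ ℕ ×ₗ WithTop ℕ))
    (point one) (contractibleSpace_point one) (vdW n k) ?_ ?_ ?_
  · rintro F rfl
    refine ⟨Finset.singleton_nonempty _, 1, 1, by omega, le_rfl, by omega, by omega, ?_⟩
    intro z hz
    have : z = 1 := by simpa [one] using hz
    exact mem_progression.2 ⟨0, by omega, by omega⟩
  · intro F hF G hG hFG
    rw [Prod.Lex.toLex_le_toLex]
    have hsub : val F ⊆ val G := Finset.map_subset_map.2 hFG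
    have hle : top F ≤ top G := Finset.sup_mono hsub
    rcases hle.lt_or_eq with h | h
    · have := htopn G
      exact Or.inl (by simp only; omega)
    · refine Or.inr ⟨by simp only [h], ?_⟩
      obtain ⟨h2, hF'⟩ := (hface F).1 hF
      obtain ⟨-, hG'⟩ := (hface G).1 hG
      simp only
      rw [← h] at hG' ⊢
      exact (hkey _ h2).1 _ _ hF' hG' hsub
  · intro F hF
    obtain ⟨h2, hF'⟩ := (hface F).1 hF
    obtain ⟨v, hv1, hvt, hv⟩ := (hkey _ h2).2 _ hF'
    refine ⟨⟨v, Finset.mem_Icc.2 ⟨hv1, hvt.le.trans (htopn F)⟩⟩, fun G hG hGF => ?_⟩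
    obtain ⟨hGt, hGk⟩ := Prod.ext_iff.1 (toLex.injective hGF)
    simp only at hGt hGk
    have hGt' : top G = top F := by have := htopn F; have := htopn G; omega
    obtain ⟨-, hG'⟩ := (hface G).1 hG
    rw [hGt'] at hG' hGk
    obtain ⟨⟨h3, h4⟩, h5, h6⟩ := hv _ hG' hGk
    have hins : val (insert ⟨v, Finset.mem_Icc.2 ⟨hv1, hvt.le.trans (htopn F)⟩⟩ G)
        = insert v (val G) := Finset.map_insert _ _ _
    have hera : val (G.erase ⟨v, Finset.mem_Icc.2 ⟨hv1, hvt.le.trans (htopn F)⟩⟩)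
        = (val G).erase v := Finset.map_erase _ _ _
    have hGle : ∀ z ∈ val G, z ≤ top F := fun z hz => hGt' ▸ (hval G z hz).2
    have tins := htopI _ _ (hins ▸ h3.1) fun z hz => by
      rw [hins] at hz
      rcases Finset.mem_insert.1 hz with rfl | hz
      · exact hvt.le
      · exact hGle z hz
    have tera := htopI _ _ (hera ▸ h5.1) fun z hz => by
      rw [hera] at hz
      exact hGle z (Finset.mem_of_mem_erase hz)
    refine ⟨⟨(hface _).2 ?_, ?_⟩, ⟨(hface _).2 ?_, ?_⟩⟩
    · rw [tins, hins]; exact ⟨h2, h3⟩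
    · simp only [tins, hins, h4]
    · rw [tera, hera]; exact ⟨h2, h5⟩
    · simp only [tera, hera, h6]

end VanDerWaerden

theorem theorem4p6 (a k n : ℕ) (ha : 1 < a)
    (hk : (VanDerWaerden.L a : ℚ) / (VanDerWaerden.M a : ℚ) ≤ (k : ℚ))
    (hkn : k < n) (hn : n ≤ (a + 1) * k) :
    ContractibleSpace (VanDerWaerden.realization (VanDerWaerden.vdW n k)) :=
  VanDerWaerden.contractibleSpace_realization_vdW a k n ha hk hkn hn
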